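/- Let $X$ be a real Hilbert space, whose dual is identified with $X$ through the inner product, and let $\varphi: X\to(-\infty,\infty]$ be lower semicontinuous (l.s.c.) and prox-bounded, i.e. there are $\alpha,\beta\in\mathbb{R}$ and $z\in X$ with $\varphi(x)\ge\alpha\|x-z\|^2+\beta$ for all $x\in X$. Let $\bar x\in X$ with $\varphi(\bar x)<\infty$ and let $\bar x^*\in\partial\varphi(\bar x)$. Here $\partial$ denotes the limiting subdifferential: for a function $f$ and a point $x$ with $f(x)<\infty$, $x^*\in\partial f(x)$ means that there are $\varepsilon_k\downarrow 0$, $x_k\to x$ with $f(x_k)\to f(x)$, and $x_k^*\to x^*$ weakly such that, for every $k$, $f(x_k)<\infty$ and $$\liminf_{y\to x_k}\frac{f(y)-f(x_k)-\langle x_k^*,y-x_k\rangle}{\|y-x_k\|}\ge-\varepsilon_k;$$ $\partial f(x)=\emptyset$ if $f(x)=\infty$, and $\operatorname{gph}\partial f=\{(x,x^*): x^*\in\partial f(x)\}$. Consider the following properties. (i) $\varphi$ is variationally convex at $\bar x$ for $\bar x^*$: there are open convex sets $U\ni\bar x$ and $V\ni\bar x^*$, a convex l.s.c. function $\widehat\varphi\le\varphi$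 on $U$ with values in $(-\infty,\infty]$, and $\varepsilon>0$ such that, with $U_\varepsilon:=\{x\in U:\varphi(x)<\varphi(\bar x)+\varepsilon\}$, $$(U_\varepsilon\times V)\cap\operatorname{gph}\partial\varphi=(U\times V)\cap\operatorname{gph}\partial\widehat\varphi,$$ and $\varphi(x)=\widehat\varphi(x)$ at the common elements $(x,x^*)$ of these sets. (ii) $\varphi$ is prox-regular at $\bar x$ for $\bar x^*$, i.e. there are $\varepsilon>0$ and $r\ge0$ such that $$\varphi(x)\ge\varphi(u)+\langle u^*,x-u\rangle-\tfrac r2\|x-u\|^2$$ whenever $\|x-\bar x\|\le\varepsilon$, $u^*\in\partial\varphi(u)$, $\|u-\bar x\|\le\varepsilon$, $\|u^*-\bar x^*\|\le\varepsilon$ and $\varphi(u)<\varphi(\bar x)+\varepsilon$; and there is $\lambda_0>0$ such that for every $\lambda\in(0,\lambda_0)$ the Moreau envelope $$e_\lambda\varphi(x):=\inf_{w\in X}\Big\{\varphi(w)+\frac1{2\lambda}\|w-x\|^2\Big\}$$ is locally convex around $\bar x+\lambda\bar x^*$, i.e. convex on some convex neighborhood (which may depend on $\lambda$) of this point. Then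 (i) implies (ii). Conversely, (ii) implies (i) if $\varphi$ is weakly sequentially l.s.c. around $\bar x$, i.e. if there is a norm neighborhood $W$ of $\bar x$ such that $\liminf_{k\to\infty}\varphi(x_k)\ge\varphi(x)$ for every $x\in W$ and every sequence $(x_k)$ in $X$ converging weakly to $x$. -/

import Mathlib

open Filter Topology

noncomputable section

namespace VarConv

variable {X : Type*} [NormedAddCommGroup X] [InnerProductSpace ℝ X]

/-!
Extended-real-valued functions `φ : X → (-∞, ∞]` are modelled as functions `X → EReal` that do not
take the value `⊥`.  The space `X` is a real Hilbert space and its dual is identified with `X`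
through the inner product, so that subgradients are vectors of `X`.
-/

/-- Weak convergence of a sequence in a Hilbert space (equal to weak-star convergence under the
identification of the dual with the space). -/
def WeaklyConverges (u : ℕ → X) (x : X) : Prop :=
  ∀ v : X, Tendsto (fun k => inner ℝ (u k) v) atTop (𝓝 (inner ℝ x v))

/-- The `ε`-regular subdifferential of `φ` at `x`; it is empty outside the domain of `φ`. -/
def epsRegularSubdifferential (ε : ℝ) (φ : X → EReal) (x : X) : Set X :=
  {v | φ x ≠ ⊤ ∧
    ((-ε : ℝ) : EReal) ≤
      liminf (fun y => (φ y - φ x - ((inner ℝ v (y - x) : ℝ) : EReal)) / ((‖y - x‖ : ℝ) : EReal))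
        (𝓝[≠] x)}

/-- The limiting (Mordukhovich) subdifferential of `φ` at `x`: weak limits of
`ε k`-regular subgradients at points `u k` with `u k → x`, `φ (u k) → φ x`, and `ε k ↓ 0`. -/
def limitingSubdifferential (φ : X → EReal) (x : X) : Set X :=
  {v | φ x ≠ ⊤ ∧
    ∃ (ε : ℕ → ℝ) (u : ℕ → X) (w : ℕ → X),
      (∀ k, 0 ≤ ε k) ∧ Tendsto ε atTop (𝓝 0) ∧
      Tendsto u atTop (𝓝 x) ∧ Tendsto (fun k => φ (u k)) atTop (𝓝 (φ x)) ∧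
      (∀ k, w k ∈ epsRegularSubdifferential (ε k) φ (u k)) ∧
      WeaklyConverges w v}

/-- `f` is a convex function on the convex set `U` with values in `(-∞, ∞]`. -/
def ExtConvexOn (U : Set X) (f : X → EReal) : Prop :=
  Convex ℝ U ∧ (∀ x ∈ U, f x ≠ ⊥) ∧
    ∀ x ∈ U, ∀ y ∈ U, ∀ a b : ℝ, 0 < a → 0 < b → a + b = 1 →
      f (a • x + b • y) ≤ (a : EReal) * f x + (b : EReal) * f y

/-- `f` is locally convex around `z`: it is convex on some (open) convex neighborhood of `z`. -/
def LocallyConvexAround (f : X → EReal) (z : X) : Prop :=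
  ∃ U : Set X, IsOpen U ∧ z ∈ U ∧ ExtConvexOn U f

/-- `φ` is variationally convex at `x₀` for `v₀`.  Only the values of `ψ` on the open set `U`
matter: its limiting subdifferential at points of `U` is determined by them. -/
def VariationallyConvex (φ : X → EReal) (x₀ v₀ : X) : Prop :=
  ∃ U V : Set X, IsOpen U ∧ Convex ℝ U ∧ x₀ ∈ U ∧ IsOpen V ∧ Convex ℝ V ∧ v₀ ∈ V ∧
    ∃ ψ : X → EReal, ExtConvexOn U ψ ∧ LowerSemicontinuousOn ψ U ∧ (∀ x ∈ U, ψ x ≤ φ x) ∧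
      ∃ ε : ℝ, 0 < ε ∧
        {p : X × X | (p.1 ∈ U ∧ φ p.1 < φ x₀ + (ε : EReal)) ∧ p.2 ∈ V ∧
            p.2 ∈ limitingSubdifferential φ p.1} =
          {p : X × X | p.1 ∈ U ∧ p.2 ∈ V ∧ p.2 ∈ limitingSubdifferential ψ p.1} ∧
        ∀ x ∈ U, ∀ v ∈ V, v ∈ limitingSubdifferential ψ x → φ x = ψ x

/-- `φ` is prox-bounded: it has a quadratic minorant. -/
def ProxBounded (φ : X → EReal) : Prop :=
  ∃ (α β : ℝ) (x₀ : X), ∀ x, ((α * ‖x - x₀‖ ^ 2 + β : ℝ) : EReal) ≤ φ x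

/-- `φ` is prox-regular at `x₀` for `v₀` (where `v₀` is a limiting subgradient of `φ` at `x₀`). -/
def ProxRegular (φ : X → EReal) (x₀ v₀ : X) : Prop :=
  ∃ ε r : ℝ, 0 < ε ∧ 0 ≤ r ∧
    ∀ x ∈ Metric.closedBall x₀ ε, ∀ u ∈ Metric.closedBall x₀ ε, ∀ v ∈ Metric.closedBall v₀ ε,
      v ∈ limitingSubdifferential φ u → φ u < φ x₀ + (ε : EReal) →
        φ u + ((inner ℝ v (x - u) - r / 2 * ‖x - u‖ ^ 2 : ℝ) : EReal) ≤ φ x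

/-- The Moreau envelope of `φ` with parameter `l`. -/
def moreauEnvelope (l : ℝ) (φ : X → EReal) (x : X) : EReal :=
  ⨅ w : X, φ w + (((2 * l)⁻¹ * ‖w - x‖ ^ 2 : ℝ) : EReal)

/-- `φ` is weakly sequentially lower semicontinuous at `x`. -/
def WeakSeqLSCAt (φ : X → EReal) (x : X) : Prop :=
  ∀ u : ℕ → X, WeaklyConverges u x → φ x ≤ liminf (fun k => φ (u k)) atTop

/-- `φ` is weakly sequentially lower semicontinuous around `x₀`: at every point of some
(norm) neighborhood of `x₀`. -/
def WeakSeqLSCAround (φ : X → EReal) (x₀ : X) : Prop :=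
  ∀ᶠ x in 𝓝 x₀, WeakSeqLSCAt φ x

end VarConv

end

/-! Both directions rest on proximal points. If `p` minimizes `φ + (2 * l)⁻¹ * ‖· - z‖ ^ 2`,
completing the square turns minimality into a quadratic minorant of `φ` touching at `p` with slope
`g = l⁻¹ • (z - p)`. So `g` is a subgradient at `p`, and `z = p + l • g`.

From (i) to (ii): near `(x₀, v₀)` subgradients of `φ` are subgradients of the convex `ψ ≤ φ`, with
equal values, so `φ` inherits their affine minorants. For `z` near `x₀ + l • v₀`, the proximal point
`p` of `ψ` on a ball satisfies `φ p = ψ p`. The envelope of the affine minorant at `p` supports the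
envelope of `φ` at `z`; prox-boundedness controls points far from `x₀`. A function supported from
below by an affine function at each point is convex.

From (ii) to (i): prox-regularity and prox-boundedness give quadratic minorants at nearby
subgradients, and `ExtConvexOn.affine_le_of_moreauEnvelope` upgrades them to affine ones near `x₀`.
The convex minorant is the supremum of these affine functions. If `v` is a subgradient of it at `u`,
then `u + l • v` has a proximal point for `φ`, by weak compactness and weak lower semicontinuity,
and monotonicity of convex subgradients identifies that point with `u`. -/

namespace VarConv

variable {X : Type*} [NormedAddCommGroup X] [InnerProductSpace ℝ X]

/-! ### Subgradients of convex functions -/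

/-- A local quadratic minorant at `p` with slope `v` makes `v` a regular subgradient. -/
theorem mem_epsRegularSubdifferential_of_quadratic {φ : X → EReal} {p v : X} {a c : ℝ}
    (ha : φ p = a)
    (h : ∀ᶠ x in 𝓝 p, ((a + inner ℝ v (x - p) - c * ‖x - p‖ ^ 2 : ℝ) : EReal) ≤ φ x) :
    v ∈ epsRegularSubdifferential 0 φ p := by
  refine ⟨by simp [ha], ?_⟩
  refine EReal.ge_of_forall_gt_iff_ge.1 fun b hb => ?_
  have hb : b < 0 := by simpa using hb
  refine le_liminf_of_le (by isBoundedDefault) ?_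
  have hlim : Tendsto (fun x => c * ‖x - p‖) (𝓝 p) (𝓝 0) := by
    have : Continuous fun x : X => c * ‖x - p‖ := by fun_prop
    simpa using this.tendsto p
  have hev : ∀ᶠ x in 𝓝 p, c * ‖x - p‖ < -b := hlim.eventually_lt_const (by linarith)
  filter_upwards [nhdsWithin_le_nhds h, nhdsWithin_le_nhds hev, self_mem_nhdsWithin]
    with x hx hxb hxp
  have hpos : 0 < ‖x - p‖ := norm_pos_iff.2 (sub_ne_zero.2 hxp)
  rw [EReal.le_div_iff_mul_le (by exact_mod_cast hpos) (EReal.coe_ne_top _), ha]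
  induction hφ : φ x with
  | bot => exact absurd (le_bot_iff.1 (hφ ▸ hx)) (EReal.coe_ne_bot _)
  | top => simp [sub_eq_add_neg, ← EReal.coe_neg]
  | coe y =>
    rw [hφ] at hx
    norm_cast at hx ⊢
    nlinarith

theorem mem_limitingSubdifferential_of_quadratic {φ : X → EReal} {p v : X} {a c : ℝ}
    (ha : φ p = a)
    (h : ∀ᶠ x in 𝓝 p, ((a + inner ℝ v (x - p) - c * ‖x - p‖ ^ 2 : ℝ) : EReal) ≤ φ x) :
    v ∈ limitingSubdifferential φ p :=
  ⟨by simp [ha], fun _ => 0, fun _ => p, fun _ => v, fun _ => le_rfl, tendsto_const_nhds,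
    tendsto_const_nhds, tendsto_const_nhds,
    fun _ => mem_epsRegularSubdifferential_of_quadratic ha h, fun _ => tendsto_const_nhds⟩

/-- Convexity turns the local inequality defining an `ε`-regular subgradient into a global one. -/
theorem ExtConvexOn.le_of_mem_epsRegularSubdifferential {U : Set X} {ψ : X → EReal}
    (hψ : ExtConvexOn U ψ) {u w x : X} {ε a : ℝ} (hu : u ∈ U) (ha : ψ u = a)
    (hw : w ∈ epsRegularSubdifferential ε ψ u) (hx : x ∈ U) :
    ((a + inner ℝ w (x - u) - ε * ‖x - u‖ : ℝ) : EReal) ≤ ψ x := by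
  rcases eq_or_ne x u with rfl | hne
  · simp [ha]
  have hpos : 0 < ‖x - u‖ := norm_pos_iff.2 (sub_ne_zero.2 hne)
  induction hψx : ψ x with
  | bot => exact absurd hψx (hψ.2.1 x hx)
  | top => exact le_top
  | coe b =>
    norm_cast
    refine le_of_forall_pos_le_add fun η hη => ?_
    -- With this slack in the slope, the error at the point of parameter `t` on the segment from `u`
    -- to `x` is `t * η`, which survives division by `t`.
    have hη' : 0 < η / ‖x - u‖ := div_pos hη hpos
    have hlt : ((-(ε + η / ‖x - u‖) : ℝ) : EReal) < liminf (fun y => (ψ y - ψ u -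
        ((inner ℝ w (y - u) : ℝ) : EReal)) / ((‖y - u‖ : ℝ) : EReal)) (𝓝[≠] u) :=
      lt_of_lt_of_le (by norm_cast; linarith) hw.2
    have hev := eventually_lt_of_lt_liminf hlt (by isBoundedDefault)
    rw [eventually_nhdsWithin_iff] at hev
    have hlim : Tendsto (fun t : ℝ => (1 - t) • u + t • x) (𝓝[>] 0) (𝓝 u) := by
      have : Continuous fun t : ℝ => (1 - t) • u + t • x := by fun_prop
      simpa using (this.tendsto 0).mono_left nhdsWithin_le_nhds
    have hlt1 : ∀ᶠ t : ℝ in 𝓝[>] 0, t < 1 :=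
      nhdsWithin_le_nhds (eventually_lt_nhds one_pos)
    obtain ⟨t, ht, ht1, ht0⟩ :=
      ((hlim.eventually hev).and (hlt1.and self_mem_nhdsWithin)).exists
    have ht0 : 0 < t := ht0
    have hsub : (1 - t) • u + t • x - u = t • (x - u) := by module
    have hne' : (1 - t) • u + t • x ≠ u := fun h => by
      rw [← sub_eq_zero, hsub, smul_eq_zero, sub_eq_zero] at h
      exact h.elim ht0.ne' hne
    have h1 := ht hne'
    rw [hsub, norm_smul, Real.norm_of_nonneg ht0.le, inner_smul_right,
      EReal.lt_div_iff (by exact_mod_cast mul_pos ht0 hpos) (EReal.coe_ne_top _), ha] at h1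
    have h2 := hψ.2.2 u hu x hx (1 - t) t (by linarith) ht0 (by ring)
    rw [ha, hψx] at h2
    induction hy : ψ ((1 - t) • u + t • x) with
    | bot => rw [hy] at h1; simp [sub_eq_add_neg] at h1
    | top => rw [hy] at h2; norm_cast at h2
    | coe y =>
      rw [hy] at h1 h2
      norm_cast at h1 h2
      have h3 : η / ‖x - u‖ * ‖x - u‖ = η := div_mul_cancel₀ _ hpos.ne'
      have h4 : 0 < t * (b - a - inner ℝ w (x - u) + ε * ‖x - u‖ + η) := by
        rw [← h3]; nlinarith
      have h5 := pos_of_mul_pos_right h4 ht0.le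
      linarith

/-- Uniform boundedness principle. -/
theorem WeaklyConverges.exists_norm_le [CompleteSpace X] {w : ℕ → X} {v : X}
    (h : WeaklyConverges w v) : ∃ C, ∀ k, ‖w k‖ ≤ C := by
  obtain ⟨C, hC⟩ := banach_steinhaus (g := fun k => innerSL ℝ (w k)) fun x => by
    obtain ⟨C, hC⟩ := (h x).norm.bddAbove_range
    exact ⟨C, fun k => hC ⟨k, rfl⟩⟩
  exact ⟨C, fun k => by simpa using hC k⟩

theorem WeaklyConverges.tendsto_inner [CompleteSpace X] {w y : ℕ → X} {v z : X}
    (h : WeaklyConverges w v) (hy : Tendsto y atTop (𝓝 z)) :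
    Tendsto (fun k => (inner ℝ (w k) (y k) : ℝ)) atTop (𝓝 (inner ℝ v z)) := by
  obtain ⟨C, hC⟩ := h.exists_norm_le
  have h0 : Tendsto (fun k => (inner ℝ (w k) (y k - z) : ℝ)) atTop (𝓝 0) := by
    refine squeeze_zero_norm (a := fun k => C * ‖y k - z‖) (fun k => ?_) ?_
    · exact (norm_inner_le_norm _ _).trans (by gcongr; exact hC k)
    · simpa using (tendsto_iff_norm_sub_tendsto_zero.1 hy).const_mul C
  simpa [inner_sub_right] using h0.add (h z)

/-- Limiting subgradients of a convex function are subgradients in the sense of convex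
analysis. -/
theorem ExtConvexOn.le_of_mem_limitingSubdifferential [CompleteSpace X] {U : Set X}
    {ψ : X → EReal} (hU : IsOpen U) (hψ : ExtConvexOn U ψ) {u v x : X} {a : ℝ} (hu : u ∈ U)
    (ha : ψ u = a) (hv : v ∈ limitingSubdifferential ψ u) (hx : x ∈ U) :
    ((a + inner ℝ v (x - u) : ℝ) : EReal) ≤ ψ x := by
  obtain ⟨-, ε, p, w, -, hε, hp, hψp, hw, hwv⟩ := hv
  induction hψx : ψ x with
  | bot => exact absurd hψx (hψ.2.1 x hx)
  | top => exact le_top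
  | coe b =>
    norm_cast
    have hreal : Tendsto (fun k => (ψ (p k)).toReal) atTop (𝓝 a) := by
      have := (EReal.tendsto_toReal (a := ψ u) (by simp [ha]) (by simp [ha])).comp hψp
      simpa [ha, Function.comp_def] using this
    have hsub : Tendsto (fun k => x - p k) atTop (𝓝 (x - u)) := tendsto_const_nhds.sub hp
    have hlim := (hreal.add (hwv.tendsto_inner hsub)).sub (hε.mul hsub.norm)
    rw [zero_mul, sub_zero] at hlim
    refine le_of_tendsto hlim ?_
    filter_upwards [hp.eventually (hU.mem_nhds hu)] with k hk
    have hcoe : ψ (p k) = ((ψ (p k)).toReal : EReal) :=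
      (EReal.coe_toReal (hw k).1 (hψ.2.1 _ hk)).symm
    have := hψ.le_of_mem_epsRegularSubdifferential hk hcoe (hw k) hx
    rw [hψx] at this
    exact_mod_cast this

/-- A function with an affine minorant at each point of a convex set is convex there. -/
theorem extConvexOn_of_subgradient {U : Set X} {f : X → EReal} (hU : Convex ℝ U)
    (h : ∀ z ∈ U, ∃ (a : ℝ) (g : X), f z = a ∧
      ∀ x ∈ U, ((a + inner ℝ g (x - z) : ℝ) : EReal) ≤ f x) : ExtConvexOn U f := by
  refine ⟨hU, fun x hx => ?_, fun x hx y hy s t hs ht hst => ?_⟩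
  · obtain ⟨a, -, ha, -⟩ := h x hx
    simp [ha]
  · obtain ⟨c, g, hc, hg⟩ := h _ (hU hx hy hs.le ht.le hst)
    obtain ⟨a, -, ha, -⟩ := h x hx
    obtain ⟨b, -, hb, -⟩ := h y hy
    have h1 := hg x hx
    have h2 := hg y hy
    rw [ha] at h1
    rw [hb] at h2
    rw [hc, ha, hb]
    norm_cast at h1 h2 ⊢
    have h3 : s * inner ℝ g (x - (s • x + t • y)) + t * inner ℝ g (y - (s • x + t • y)) = 0 := by
      rw [← inner_smul_right, ← inner_smul_right, ← inner_add_right]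
      have : s • (x - (s • x + t • y)) + t • (y - (s • x + t • y)) = 0 := by
        obtain rfl : t = 1 - s := by linarith
        module
      rw [this, inner_zero_right]
    obtain rfl : t = 1 - s := by linarith
    nlinarith

/-! ### Weak compactness and coercivity -/

/-- Bounded sequences of a Hilbert space have weakly convergent subsequences. -/
theorem exists_weaklyConverges_subseq [CompleteSpace X] {w : ℕ → X} {C : ℝ}
    (hC : ∀ k, ‖w k‖ ≤ C) :
    ∃ (p : X) (n : ℕ → ℕ), StrictMono n ∧ WeaklyConverges (w ∘ n) p := by
  -- Sequential compactness in the weak-star topology needs separability, hence the closed span of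
  -- the sequence. Test vectors outside it are replaced by their orthogonal projections.
  let S : Submodule ℝ X := (Submodule.span ℝ (Set.range w)).topologicalClosure
  have hwS : ∀ k, w k ∈ S := fun k =>
    Submodule.le_topologicalClosure _ (Submodule.subset_span ⟨k, rfl⟩)
  have hclosed : IsClosed (S : Set X) := Submodule.isClosed_topologicalClosure _
  have : CompleteSpace S := hclosed.completeSpace_coe
  have : TopologicalSpace.SeparableSpace S := by
    have h1 : TopologicalSpace.IsSeparable (S : Set X) := by
      rw [Submodule.topologicalClosure_coe]
      exact ((Set.countable_range w).isSeparable.span (R := ℝ)).closure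
    exact h1.separableSpace
  let F : ℕ → WeakDual ℝ S := fun k => StrongDual.toWeakDual (innerSL ℝ (⟨w k, hwS k⟩ : S))
  obtain ⟨f, -, n, hn, hf⟩ := WeakDual.isSeqCompact_closedBall ℝ S 0 C (x := F) fun k => by
    simpa [F] using hC k
  let q : S := (InnerProductSpace.toDual ℝ S).symm (WeakDual.toStrongDual f)
  refine ⟨q, n, hn, fun v => ?_⟩
  have hproj : ∀ y : S, (inner ℝ (y : X) v : ℝ) = inner ℝ y (S.orthogonalProjectionOnto v) := fun y => by
    rw [Submodule.inner_orthogonalProjectionOnto_eq_of_mem_left]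
  have hev := ((WeakDual.eval_continuous (𝕜 := ℝ) (E := S)
    (S.orthogonalProjectionOnto v)).tendsto f).comp hf
  have hq : (inner ℝ (q : X) v : ℝ) = f (S.orthogonalProjectionOnto v) := by
    rw [hproj, InnerProductSpace.toDual_symm_apply]
    rfl
  rw [hq]
  refine hev.congr fun k => ?_
  exact (hproj ⟨w (n k), hwS _⟩).symm

/-- For small parameters the quadratic term dominates a prox-bounded function away from the
centre, uniformly in the centre and in a bounded slope. -/
theorem ProxBounded.exists_coercive {φ : X → EReal} (h : ProxBounded φ) (x₀ : X) {δ : ℝ}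
    (hδ : 0 < δ) (M K : ℝ) :
    ∃ l₀ : ℝ, 0 < l₀ ∧ ∀ l, 0 < l → l < l₀ → ∀ u v x : X, ‖u - x₀‖ ≤ 1 → ‖v‖ ≤ K →
      δ ≤ ‖x - u‖ →
      ((M + inner ℝ v (x - u) - (2 * l)⁻¹ * ‖x - u‖ ^ 2 : ℝ) : EReal) ≤ φ x := by
  obtain ⟨α, β, y, hφ⟩ := h
  set R := 1 + ‖x₀ - y‖ with hR
  -- As `1 ≤ D / δ`, constant and linear terms are bounded by multiples of `D ^ 2`; `A` collects the
  -- coefficients.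
  set A := |α| * (1 + R / δ) ^ 2 + |β| / δ ^ 2 + |M| / δ ^ 2 + |K| / δ with hA
  have hR0 : 0 ≤ R := by positivity
  have hA0 : 0 ≤ A := by positivity
  refine ⟨(2 * (A + 1))⁻¹, by positivity, fun l hl hl0 u v x hu hv hx => ?_⟩
  refine le_trans ?_ (hφ x)
  norm_cast
  set D := ‖x - u‖ with hD
  have hD0 : 0 < D := hδ.trans_le hx
  have hlA : A ≤ (2 * l)⁻¹ := by
    have h1 : 2 * (A + 1) < l⁻¹ := (lt_inv_comm₀ hl (by positivity)).1 hl0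
    rw [mul_inv]
    linarith
  have hxy : ‖x - y‖ ≤ D + R := by
    have h1 : x - y = (x - u) + ((u - x₀) + (x₀ - y)) := by abel
    rw [h1]
    refine (norm_add_le _ _).trans ?_
    linarith [norm_add_le (u - x₀) (x₀ - y)]
  have hDδ : 1 ≤ D / δ := (one_le_div hδ).2 hx
  have hR' : D + R ≤ (1 + R / δ) * D := by
    have := mul_le_mul_of_nonneg_left hDδ hR0
    have h2 : (1 + R / δ) * D = D + R * (D / δ) := by ring
    linarith
  have hsq : 1 ≤ (D / δ) ^ 2 := one_le_pow₀ hDδ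
  have hα : -(|α| * (1 + R / δ) ^ 2 * D ^ 2) ≤ α * ‖x - y‖ ^ 2 := by
    have h1 : ‖x - y‖ ^ 2 ≤ ((1 + R / δ) * D) ^ 2 := by gcongr; exact hxy.trans hR'
    have h2 := mul_le_mul_of_nonneg_left h1 (abs_nonneg α)
    have h3 := mul_le_mul_of_nonneg_right (neg_abs_le α) (sq_nonneg ‖x - y‖)
    rw [mul_pow, ← mul_assoc] at h2
    linarith
  have hβ : -(|β| / δ ^ 2 * D ^ 2) ≤ β := by
    have h1 := mul_le_mul_of_nonneg_left hsq (abs_nonneg β)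
    have h2 : |β| / δ ^ 2 * D ^ 2 = |β| * (D / δ) ^ 2 := by ring
    linarith [neg_abs_le β]
  have hM : M ≤ |M| / δ ^ 2 * D ^ 2 := by
    have h1 := mul_le_mul_of_nonneg_left hsq (abs_nonneg M)
    have h2 : |M| / δ ^ 2 * D ^ 2 = |M| * (D / δ) ^ 2 := by ring
    linarith [le_abs_self M]
  have hK : inner ℝ v (x - u) ≤ |K| / δ * D ^ 2 := by
    have h1 : ‖v‖ * D ≤ |K| * D := by gcongr; exact hv.trans (le_abs_self K)
    have h2 := mul_le_mul_of_nonneg_left hDδ (by positivity : 0 ≤ |K| * D)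
    have h3 : |K| / δ * D ^ 2 = |K| * D * (D / δ) := by ring
    linarith [real_inner_le_norm v (x - u)]
  have hq := mul_le_mul_of_nonneg_right hlA (sq_nonneg D)
  have hAD : A * D ^ 2 = |α| * (1 + R / δ) ^ 2 * D ^ 2 + |β| / δ ^ 2 * D ^ 2 +
      |M| / δ ^ 2 * D ^ 2 + |K| / δ * D ^ 2 := by
    rw [hA]; ring
  linarith

/-! ### Algebra and existence of proximal points -/

/-- Completing the square: the parabola centred at `z`, expanded about `p`, has slope `l⁻¹ • (z -
p)` there. -/
theorem prox_identity {l : ℝ} (hl : 0 < l) (m : ℝ) (p x z : X) :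
    m - (2 * l)⁻¹ * ‖p - z‖ ^ 2 + inner ℝ (l⁻¹ • (z - p)) (x - p) - (2 * l)⁻¹ * ‖x - p‖ ^ 2 =
      m - (2 * l)⁻¹ * ‖x - z‖ ^ 2 := by
  have h1 : x - z = (x - p) - (z - p) := by abel
  rw [h1, norm_sub_sq_real (x - p), real_inner_smul_left, norm_sub_rev p z,
    real_inner_comm (z - p) (x - p)]
  field_simp
  ring

/-- The Moreau envelope of an affine function minorizes the envelope. -/
theorem affine_prox_le {l : ℝ} (hl : 0 < l) (m : ℝ) (p x z z' : X) :
    m + inner ℝ (l⁻¹ • (z - p)) (z' - z) - (2 * l)⁻¹ * ‖x - z'‖ ^ 2 ≤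
      m - (2 * l)⁻¹ * ‖p - z‖ ^ 2 + inner ℝ (l⁻¹ • (z - p)) (x - p) := by
  have h1 : x - z' = (x - p - (z' - z)) - (z - p) := by abel
  have h2 : inner ℝ (l⁻¹ • (z - p)) (x - p) =
      (inner ℝ (l⁻¹ • (z - p)) (x - p - (z' - z)) + inner ℝ (l⁻¹ • (z - p)) (z' - z) : ℝ) := by
    rw [← inner_add_right]
    congr 1
    abel
  rw [h1, h2, norm_sub_sq_real (x - p - (z' - z)), norm_sub_rev p z,
    real_inner_smul_left _ (x - p - (z' - z)), real_inner_comm (z - p) (x - p - (z' - z))]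
  -- This square is exactly the difference of the two sides.
  have h3 : 0 ≤ (2 * l)⁻¹ * ‖x - p - (z' - z)‖ ^ 2 := by positivity
  have h4 : l⁻¹ = 2 * (2 * l)⁻¹ := by field_simp
  rw [h4]
  linarith

theorem inv_smul_sub_eq {l : ℝ} (hl : 0 < l) (x₀ v₀ z : X) :
    l⁻¹ • (z - x₀) = v₀ + l⁻¹ • (z - (x₀ + l • v₀)) := by
  rw [← sub_sub, smul_sub _ (z - x₀), smul_smul, inv_mul_cancel₀ hl.ne', one_smul]
  abel

/-- A point that improves on `x₀` in the proximal problem is close to `x₀`. -/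
theorem norm_sub_le_of_prox {l r a m : ℝ} (hl : 0 < l) (hrl : r * l ≤ 1 / 2) {p z x₀ v₀ : X}
    (h1 : a + inner ℝ v₀ (p - x₀) - r / 2 * ‖p - x₀‖ ^ 2 ≤ m - (2 * l)⁻¹ * ‖p - z‖ ^ 2)
    (h2 : m - (2 * l)⁻¹ * ‖x₀ - z‖ ^ 2 ≤ a) :
    ‖p - x₀‖ ≤ 4 * ‖z - (x₀ + l • v₀)‖ := by
  have h3 := prox_identity hl m x₀ p z
  rw [inv_smul_sub_eq hl x₀ v₀ z, inner_add_left, real_inner_smul_left] at h3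
  have h5 := real_inner_le_norm (z - (x₀ + l • v₀)) (p - x₀)
  set d := ‖p - x₀‖
  set h := ‖z - (x₀ + l • v₀)‖
  have hd : 0 ≤ d := norm_nonneg _
  have hh : 0 ≤ h := norm_nonneg _
  -- Expanded about `x₀`, the terms in `v₀` cancel. What is left is `(1 - r * l) * d ^ 2 ≤ 2 * h *
  -- d`, and `r * l ≤ 1 / 2` produces the factor 4.
  have h6 : (2 * l)⁻¹ * d ^ 2 - r / 2 * d ^ 2 ≤ l⁻¹ * (h * d) := by
    have := mul_le_mul_of_nonneg_left h5 (inv_nonneg.2 hl.le)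
    linarith
  have h7 : d ^ 2 - r * l * d ^ 2 ≤ 2 * (h * d) := by
    have := mul_le_mul_of_nonneg_left h6 (by positivity : 0 ≤ 2 * l)
    field_simp at this
    nlinarith
  have h8 : d * d ≤ 4 * h * d := by nlinarith [sq_nonneg d]
  rcases hd.eq_or_lt with h0 | h0
  · rw [← h0]; positivity
  · exact le_of_mul_le_mul_right h8 h0

theorem norm_smul_sub_sub_le {l : ℝ} (hl : 0 < l) {p z x₀ v₀ : X}
    (h : ‖p - x₀‖ ≤ 4 * ‖z - (x₀ + l • v₀)‖) :
    ‖l⁻¹ • (z - p) - v₀‖ ≤ 5 * ‖z - (x₀ + l • v₀)‖ / l := by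
  have h1 : l⁻¹ • (z - p) - v₀ = l⁻¹ • ((z - (x₀ + l • v₀)) - (p - x₀)) := by
    have : z - (x₀ + l • v₀) - (p - x₀) = (z - p) - l • v₀ := by abel
    rw [this, smul_sub _ (z - p), smul_smul, inv_mul_cancel₀ hl.ne', one_smul]
  rw [h1, norm_smul, norm_inv, Real.norm_of_nonneg hl.le, inv_mul_eq_div]
  gcongr
  linarith [norm_sub_le (z - (x₀ + l • v₀)) (p - x₀)]

theorem le_moreauEnvelope {X : Type*} [NormedAddCommGroup X] {φ : X → EReal} {l c : ℝ} {z : X}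
    (h : ∀ x, ((c - (2 * l)⁻¹ * ‖x - z‖ ^ 2 : ℝ) : EReal) ≤ φ x) :
    (c : EReal) ≤ moreauEnvelope l φ z := by
  refine le_iInf fun x => ?_
  calc (c : EReal) = ((c - (2 * l)⁻¹ * ‖x - z‖ ^ 2 : ℝ) : EReal) +
        (((2 * l)⁻¹ * ‖x - z‖ ^ 2 : ℝ) : EReal) := by norm_cast; ring
    _ ≤ _ := by gcongr; exact h x

theorem moreauEnvelope_le {X : Type*} [NormedAddCommGroup X] {φ : X → EReal} {l a : ℝ} {p : X} (z : X) (h : φ p = a) :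
    moreauEnvelope l φ z ≤ ((a + (2 * l)⁻¹ * ‖p - z‖ ^ 2 : ℝ) : EReal) := by
  refine (iInf_le _ p).trans ?_
  rw [h]
  norm_cast

/-- Minimizing sequences for `f + q` on `B`. -/
theorem exists_minimizing_seq {X : Type*} {f : X → EReal} {q : X → ℝ} {B : Set X} {x₀ : X} {a b : ℝ}
    (hx₀ : x₀ ∈ B) (ha : f x₀ = a) (hb : ∀ x ∈ B, ((b - q x : ℝ) : EReal) ≤ f x) :
    ∃ (m : ℝ) (w : ℕ → X) (t : ℕ → ℝ), (∀ x ∈ B, ((m - q x : ℝ) : EReal) ≤ f x) ∧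
      (∀ n, w n ∈ B) ∧ (∀ n, f (w n) ≤ ((t n - q (w n) : ℝ) : EReal)) ∧
      (∀ n, t n < m + 1 / ((n : ℝ) + 1)) ∧ Tendsto t atTop (𝓝 m) := by
  -- Real upper bounds for values of `f + q` on `B`; their infimum is the infimum of `f + q`.
  set T : Set ℝ := {t | ∃ x ∈ B, f x ≤ ((t - q x : ℝ) : EReal)} with hT
  have hne : T.Nonempty := ⟨a + q x₀, x₀, hx₀, by rw [ha]; simp⟩
  have hbdd : BddBelow T := by
    refine ⟨b, ?_⟩
    rintro t ⟨x, hx, hxt⟩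
    have := (hb x hx).trans hxt
    norm_cast at this
    linarith
  have hex : ∀ n : ℕ, ∃ t ∈ T, t < sInf T + 1 / ((n : ℝ) + 1) := fun n =>
    exists_lt_of_csInf_lt hne (lt_add_of_pos_right _ (by positivity))
  choose t ht hlt using hex
  choose w hwB hw using ht
  have hle : ∀ n, sInf T ≤ t n := fun n => csInf_le hbdd ⟨w n, hwB n, hw n⟩
  refine ⟨sInf T, w, t, fun x hx => ?_, hwB, hw, hlt, ?_⟩
  · refine EReal.le_of_forall_lt_iff_le.1 fun y hy => ?_
    have : sInf T ≤ y + q x := csInf_le hbdd ⟨x, hx, by simpa using hy.le⟩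
    norm_cast
    linarith
  · refine tendsto_of_tendsto_of_tendsto_of_le_of_le tendsto_const_nhds ?_ hle
      (fun n => (hlt n).le)
    simpa using tendsto_one_div_add_atTop_nhds_zero_nat.const_add (sInf T)

/-- Proximal points of convex functions on closed sets. -/
theorem ExtConvexOn.exists_prox [CompleteSpace X] {f : X → EReal} {B : Set X}
    (hf : ExtConvexOn B f) (hB : IsClosed B) (hlsc : LowerSemicontinuousOn f B) {x₀ z : X}
    {a b l : ℝ} (hl : 0 < l) (hx₀ : x₀ ∈ B) (ha : f x₀ = a)
    (hb : ∀ x ∈ B, ((b - (2 * l)⁻¹ * ‖x - z‖ ^ 2 : ℝ) : EReal) ≤ f x) :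
    ∃ p ∈ B, ∃ m : ℝ, f p = ((m - (2 * l)⁻¹ * ‖p - z‖ ^ 2 : ℝ) : EReal) ∧
      ∀ x ∈ B, ((m - (2 * l)⁻¹ * ‖x - z‖ ^ 2 : ℝ) : EReal) ≤ f x := by
  obtain ⟨m, w, t, hm, hwB, hw, ht, htm⟩ := exists_minimizing_seq hx₀ ha hb
  -- Strong convexity of the quadratic term: the midpoint of `w n` and `w k` cannot go below `m`, so
  -- the parallelogram law bounds their distance and the minimizing sequence is Cauchy.
  have key : ∀ n k, ‖w n - w k‖ ^ 2 ≤ 4 * l * ((t n - m) + (t k - m)) := fun n k => by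
    have h1 := hm _ (hf.1 (hwB n) (hwB k) (by norm_num : (0 : ℝ) ≤ 1 / 2)
      (by norm_num : (0 : ℝ) ≤ 1 / 2) (by norm_num))
    have h2 := hf.2.2 _ (hwB n) _ (hwB k) (1 / 2) (1 / 2) (by norm_num) (by norm_num)
      (by norm_num)
    have h3 := h1.trans (h2.trans (add_le_add
      (mul_le_mul_of_nonneg_left (hw n) (by norm_cast; norm_num))
      (mul_le_mul_of_nonneg_left (hw k) (by norm_cast; norm_num))))
    norm_cast at h3
    have h4 : (1 / 2 : ℝ) • w n + (1 / 2 : ℝ) • w k - z =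
        (1 / 2 : ℝ) • ((w n - z) + (w k - z)) := by module
    have h5 : w n - w k = (w n - z) - (w k - z) := by abel
    have h6 := parallelogram_law_with_norm ℝ (w n - z) (w k - z)
    rw [← h5] at h6
    rw [h4, norm_smul, Real.norm_of_nonneg (by norm_num)] at h3
    have h7 : (2 * l)⁻¹ * ‖w n - w k‖ ^ 2 ≤ 2 * ((t n - m) + (t k - m)) := by
      have h8 := congrArg (fun y => (2 * l)⁻¹ * y) h6
      nlinarith
    have h8 := mul_le_mul_of_nonneg_left h7 (by positivity : 0 ≤ 2 * l)
    rw [mul_inv_cancel_left₀ (by positivity)] at h8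
    linarith
  have hcauchy : CauchySeq w := by
    refine cauchySeq_of_le_tendsto_0 (fun N : ℕ => √(4 * l * (2 * (1 / ((N : ℝ) + 1)))))
      (fun n k N hn hk => ?_) ?_
    · rw [dist_eq_norm]
      refine Real.le_sqrt_of_sq_le ((key n k).trans ?_)
      have h1 : 1 / ((n : ℝ) + 1) ≤ 1 / ((N : ℝ) + 1) := by gcongr
      have h2 : 1 / ((k : ℝ) + 1) ≤ 1 / ((N : ℝ) + 1) := by gcongr
      gcongr
      linarith [ht n, ht k]
    · have h1 := tendsto_one_div_add_atTop_nhds_zero_nat (𝕜 := ℝ)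
      have h2 := (((h1.const_mul 2).const_mul (4 * l)).sqrt)
      simpa using h2
  obtain ⟨p, hp⟩ := cauchySeq_tendsto_of_complete hcauchy
  have hpB : p ∈ B := hB.mem_of_tendsto hp (.of_forall hwB)
  refine ⟨p, hpB, m, le_antisymm ?_ (hm p hpB), hm⟩
  by_contra! hlt
  obtain ⟨y, hy1, hy2⟩ := EReal.lt_iff_exists_real_btwn.1 hlt
  have hev := (tendsto_nhdsWithin_iff.2 ⟨hp, .of_forall hwB⟩).eventually (hlsc p hpB y hy2)
  have hlim : Tendsto (fun n => t n - (2 * l)⁻¹ * ‖w n - z‖ ^ 2) atTop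
      (𝓝 (m - (2 * l)⁻¹ * ‖p - z‖ ^ 2)) :=
    htm.sub ((((hp.sub_const z).norm).pow 2).const_mul _)
  obtain ⟨n, hn1, hn2⟩ :=
    (hev.and (hlim.eventually_lt_const (by exact_mod_cast hy1))).exists
  have := hn1.trans_le (hw n)
  norm_cast at this
  linarith

theorem mem_limitingSubdifferential_of_prox {f : X → EReal} {l m : ℝ} (hl : 0 < l) {p z : X}
    (hp : f p = ((m - (2 * l)⁻¹ * ‖p - z‖ ^ 2 : ℝ) : EReal))
    (h : ∀ᶠ x in 𝓝 p, ((m - (2 * l)⁻¹ * ‖x - z‖ ^ 2 : ℝ) : EReal) ≤ f x) :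
    l⁻¹ • (z - p) ∈ limitingSubdifferential f p := by
  refine mem_limitingSubdifferential_of_quadratic (c := (2 * l)⁻¹) hp ?_
  filter_upwards [h] with x hx
  rwa [prox_identity hl]

/-- Explains the slope bound `‖v₀‖ + 1` supplied to `ProxBounded.exists_coercive`. -/
theorem norm_inv_smul_sub_le {l : ℝ} (hl : 0 < l) {x₀ v₀ z : X}
    (h : ‖z - (x₀ + l • v₀)‖ ≤ l) : ‖l⁻¹ • (z - x₀)‖ ≤ ‖v₀‖ + 1 := by
  rw [inv_smul_sub_eq hl x₀ v₀ z]
  refine (norm_add_le _ _).trans ?_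
  gcongr
  rw [norm_smul, norm_inv, Real.norm_of_nonneg hl.le, inv_mul_eq_div]
  exact (div_le_one hl).2 h

theorem exists_coe_eq {X : Type*} {f : X → EReal} {x : X} (h : f x ≠ ⊥) (h' : f x ≠ ⊤) :
    ∃ a : ℝ, f x = a :=
  ⟨(f x).toReal, (EReal.coe_toReal h' h).symm⟩

/-! ### Variational convexity implies (ii) -/

/-- One radius `ρ` replaces `U`, `V` and `ε`. Of the graph equality, only the passage from `φ` to
`ψ` is kept. -/
theorem VariationallyConvex.exists_convex_minorant {φ : X → EReal} {x₀ v₀ : X}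
    (hdom : φ x₀ ≠ ⊤) (hsub : v₀ ∈ limitingSubdifferential φ x₀) (hbot : ∀ x, φ x ≠ ⊥)
    (h : VariationallyConvex φ x₀ v₀) :
    ∃ (ρ : ℝ) (U : Set X) (ψ : X → EReal), 0 < ρ ∧ IsOpen U ∧ Metric.closedBall x₀ ρ ⊆ U ∧
      ExtConvexOn U ψ ∧ LowerSemicontinuousOn ψ U ∧ (∀ x ∈ U, ψ x ≤ φ x) ∧
      v₀ ∈ limitingSubdifferential ψ x₀ ∧
      (∀ u ∈ Metric.closedBall x₀ ρ, ∀ v ∈ Metric.closedBall v₀ ρ,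
        v ∈ limitingSubdifferential ψ u → φ u = ψ u) ∧
      ∀ u ∈ Metric.closedBall x₀ ρ, ∀ v ∈ Metric.closedBall v₀ ρ,
        v ∈ limitingSubdifferential φ u → φ u < φ x₀ + (ρ : EReal) →
          v ∈ limitingSubdifferential ψ u := by
  obtain ⟨U, V, hU, -, hxU, hV, -, hvV, ψ, hψ, hlsc, hle, ε, hε, hgph, heq⟩ := h
  obtain ⟨ρ₁, hρ₁, hUρ⟩ := Metric.nhds_basis_closedBall.mem_iff.1 (hU.mem_nhds hxU)
  obtain ⟨ρ₂, hρ₂, hVρ⟩ := Metric.nhds_basis_closedBall.mem_iff.1 (hV.mem_nhds hvV)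
  obtain ⟨a, ha⟩ := exists_coe_eq (hbot x₀) hdom
  have hUs : Metric.closedBall x₀ (min ε (min ρ₁ ρ₂)) ⊆ U :=
    (Metric.closedBall_subset_closedBall ((min_le_right _ _).trans (min_le_left _ _))).trans hUρ
  have hVs : Metric.closedBall v₀ (min ε (min ρ₁ ρ₂)) ⊆ V :=
    (Metric.closedBall_subset_closedBall ((min_le_right _ _).trans (min_le_right _ _))).trans hVρ
  refine ⟨min ε (min ρ₁ ρ₂), U, ψ, by positivity, hU, hUs, hψ, hlsc, hle, ?_,
    fun u hu v hv hvu => heq u (hUs hu) v (hVs hv) hvu, fun u hu v hv hvu hlt => ?_⟩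
  · have h0 : (x₀, v₀) ∈ {p : X × X | (p.1 ∈ U ∧ φ p.1 < φ x₀ + (ε : EReal)) ∧ p.2 ∈ V ∧
            p.2 ∈ limitingSubdifferential φ p.1} := by
      refine ⟨⟨hxU, ?_⟩, hvV, hsub⟩
      simp only [ha]
      exact_mod_cast (by linarith : a < a + ε)
    rw [hgph] at h0
    exact h0.2.2
  · have h0 : (u, v) ∈ {p : X × X | (p.1 ∈ U ∧ φ p.1 < φ x₀ + (ε : EReal)) ∧ p.2 ∈ V ∧
            p.2 ∈ limitingSubdifferential φ p.1} := by
      refine ⟨⟨hUs hu, hlt.trans_le ?_⟩, hVs hv, hvu⟩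
      gcongr
      exact min_le_left _ _
    rw [hgph] at h0
    exact h0.2.2

theorem VariationallyConvex.proxRegular [CompleteSpace X] {φ : X → EReal} {x₀ v₀ : X}
    (hbot : ∀ x, φ x ≠ ⊥) (hdom : φ x₀ ≠ ⊤) (hsub : v₀ ∈ limitingSubdifferential φ x₀)
    (h : VariationallyConvex φ x₀ v₀) : ProxRegular φ x₀ v₀ := by
  obtain ⟨ρ, U, ψ, hρ, hU, hUρ, hψ, -, hle, -, heq, hmem⟩ :=
    h.exists_convex_minorant hdom hsub hbot
  refine ⟨ρ, 0, hρ, le_rfl, fun x hx u hu v hv hvu hlt => ?_⟩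
  have hvψ := hmem u hu v hv hvu hlt
  obtain ⟨b, hb⟩ := exists_coe_eq (hbot u) hvu.1
  have h1 := hψ.le_of_mem_limitingSubdifferential hU (hUρ hu)
    ((heq u hu v hv hvψ).symm.trans hb) hvψ (hUρ hx)
  rw [hb, ← EReal.coe_add]
  simpa using h1.trans (hle x (hUρ hx))

theorem VariationallyConvex.locallyConvexAround_moreauEnvelope [CompleteSpace X]
    {φ : X → EReal} {x₀ v₀ : X} (hbot : ∀ x, φ x ≠ ⊥) (hpb : ProxBounded φ) (hdom : φ x₀ ≠ ⊤)
    (hsub : v₀ ∈ limitingSubdifferential φ x₀) (h : VariationallyConvex φ x₀ v₀) :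
    ∃ l₀ : ℝ, 0 < l₀ ∧ ∀ l : ℝ, 0 < l → l < l₀ →
      LocallyConvexAround (moreauEnvelope l φ) (x₀ + l • v₀) := by
  obtain ⟨ρ, U, ψ, hρ, hU, hUρ, hψ, hlsc, hle, hv₀, heq, -⟩ :=
    h.exists_convex_minorant hdom hsub hbot
  obtain ⟨a, ha⟩ := exists_coe_eq (hbot x₀) hdom
  have hxρ : x₀ ∈ Metric.closedBall x₀ ρ := Metric.mem_closedBall_self hρ.le
  have haψ : ψ x₀ = a := (heq x₀ hxρ v₀ (Metric.mem_closedBall_self hρ.le) hv₀).symm.trans ha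
  have hψ₀ : ∀ x ∈ U, ((a + inner ℝ v₀ (x - x₀) : ℝ) : EReal) ≤ ψ x := fun x hx =>
    hψ.le_of_mem_limitingSubdifferential hU (hUρ hxρ) haψ hv₀ hx
  obtain ⟨l₀, hl₀, hco⟩ := hpb.exists_coercive x₀ hρ a (‖v₀‖ + 1)
  refine ⟨l₀, hl₀, fun l hl hll => ?_⟩
  -- The bound `l` keeps the slope at `x₀` within 1 of `v₀`; `ρ / 5` puts `p` in the open ball, as
  -- `‖p - x₀‖ ≤ 4 * ρ / 5`; `ρ * l / 5` gives `‖g - v₀‖ ≤ ρ`.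
  set η := min l (min (ρ / 5) (ρ * l / 5)) with hη
  have hη0 : 0 < η := by positivity
  refine ⟨Metric.ball (x₀ + l • v₀) η, Metric.isOpen_ball, Metric.mem_ball_self hη0,
    extConvexOn_of_subgradient (convex_ball _ _) fun z hz => ?_⟩
  rw [mem_ball_iff_norm] at hz
  have hz1 : ‖z - (x₀ + l • v₀)‖ < ρ / 5 :=
    hz.trans_le ((min_le_right _ _).trans (min_le_left _ _))
  have hz2 : ‖z - (x₀ + l • v₀)‖ < ρ * l / 5 :=
    hz.trans_le ((min_le_right _ _).trans (min_le_right _ _))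
  have hψB : ExtConvexOn (Metric.closedBall x₀ ρ) ψ :=
    ⟨convex_closedBall _ _, fun x hx => hψ.2.1 x (hUρ hx),
      fun x hx y hy => hψ.2.2 x (hUρ hx) y (hUρ hy)⟩
  obtain ⟨p, hpB, m, hpm, hm⟩ := hψB.exists_prox (z := z) (b := a - ‖v₀‖ * ρ)
    Metric.isClosed_closedBall (hlsc.mono hUρ) hl hxρ haψ fun x hx => by
      refine le_trans ?_ (hψ₀ x (hUρ hx))
      norm_cast
      have h1 := (neg_le_abs _).trans (abs_real_inner_le_norm v₀ (x - x₀))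
      have h2 : ‖v₀‖ * ‖x - x₀‖ ≤ ‖v₀‖ * ρ := by
        gcongr
        exact mem_closedBall_iff_norm.1 hx
      have h3 : 0 ≤ (2 * l)⁻¹ * ‖x - z‖ ^ 2 := by positivity
      linarith
  have hdist : ‖p - x₀‖ ≤ 4 * ‖z - (x₀ + l • v₀)‖ := by
    refine norm_sub_le_of_prox (r := 0) (a := a) (m := m) hl (by norm_num) ?_ ?_
    · have := hψ₀ p (hUρ hpB)
      rw [hpm] at this
      norm_cast at this
      linarith
    · have := hm x₀ hxρ
      rw [haψ] at this
      exact_mod_cast this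
  set g := l⁻¹ • (z - p) with hg
  have hgv : g ∈ Metric.closedBall v₀ ρ := by
    rw [mem_closedBall_iff_norm]
    refine (norm_smul_sub_sub_le hl hdist).trans ((div_le_iff₀ hl).2 ?_)
    linarith
  have hgψ : g ∈ limitingSubdifferential ψ p := by
    refine mem_limitingSubdifferential_of_prox hl hpm ?_
    have : p ∈ Metric.ball x₀ ρ := by
      rw [mem_ball_iff_norm]
      linarith
    filter_upwards [Metric.isOpen_ball.mem_nhds this] with x hx
    exact hm x (Metric.ball_subset_closedBall hx)
  have hφp : φ p = ((m - (2 * l)⁻¹ * ‖p - z‖ ^ 2 : ℝ) : EReal) :=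
    (heq p hpB g hgv hgψ).trans hpm
  have hψp : ∀ z' : X, ∀ x ∈ U,
      ((m + inner ℝ g (z' - z) - (2 * l)⁻¹ * ‖x - z'‖ ^ 2 : ℝ) : EReal) ≤ ψ x :=
    fun z' x hx => le_trans (EReal.coe_le_coe_iff.2 (affine_prox_le hl m p x z z'))
      (hψ.le_of_mem_limitingSubdifferential hU (hUρ hpB) hpm hgψ hx)
  have hsubg : ∀ z' ∈ Metric.ball (x₀ + l • v₀) η,
      ((m + inner ℝ g (z' - z) : ℝ) : EReal) ≤ moreauEnvelope l φ z' := fun z' hz' => by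
    refine le_moreauEnvelope fun x => ?_
    by_cases hx : x ∈ U
    · exact (hψp z' x hx).trans (hle x hx)
    · have hxδ : ρ ≤ ‖x - x₀‖ := by
        by_contra! hlt
        exact hx (hUρ (mem_closedBall_iff_norm.2 hlt.le))
      rw [mem_ball_iff_norm] at hz'
      -- By `h1` the parabola centred at `z'` lies below `a` at `x₀`. It is therefore below the
      -- parallel parabola through `(x₀, a)`, which `hco` places below `φ`.
      refine le_trans ?_ (hco l hl hll x₀ (l⁻¹ • (z' - x₀)) x (by simp)
        (norm_inv_smul_sub_le hl (hz'.le.trans (min_le_left _ _))) hxδ)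
      have h1 := hψp z' x₀ (hUρ hxρ)
      rw [haψ] at h1
      norm_cast at h1 ⊢
      have h2 := prox_identity hl (a + (2 * l)⁻¹ * ‖x₀ - z'‖ ^ 2) x₀ x z'
      linarith
  refine ⟨m, g, le_antisymm ?_ ?_, hsubg⟩
  · have h1 := moreauEnvelope_le (l := l) z hφp
    rwa [sub_add_cancel] at h1
  · simpa using hsubg z (mem_ball_iff_norm.2 hz)

/-! ### From the envelope back to affine minorants -/

/-- Local convexity of the Moreau envelope upgrades a quadratic minorant to an affine one. -/
theorem ExtConvexOn.affine_le_of_moreauEnvelope {φ : X → EReal} {O : Set X} {l b : ℝ}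
    (hl : 0 < l) (hO : IsOpen O) (he : ExtConvexOn O (moreauEnvelope l φ)) {p g x : X}
    (hp : φ p = b)
    (hq : ∀ y, ((b + inner ℝ g (y - p) - (2 * l)⁻¹ * ‖y - p‖ ^ 2 : ℝ) : EReal) ≤ φ y)
    (hpO : p + l • g ∈ O) (hxO : x + l • g ∈ O) :
    ((b + inner ℝ g (x - p) : ℝ) : EReal) ≤ φ x := by
  induction hφx : φ x with
  | bot => exact absurd (le_bot_iff.1 (hφx ▸ hq x)) (EReal.coe_ne_bot _)
  | top => exact le_top
  | coe y =>
    norm_cast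
    set q := (2 * l)⁻¹ * ‖l • g‖ ^ 2 with hqdef
    -- The minorant `hq` says that `p` attains the envelope at `p + l • g`, with value `b + q`.
    have hlow : ((b + q : ℝ) : EReal) ≤ moreauEnvelope l φ (p + l • g) := by
      refine le_moreauEnvelope fun w => le_trans (le_of_eq ?_) (hq w)
      have h1 := prox_identity hl (b + q) p w (p + l • g)
      have h2 : p + l • g - p = l • g := by abel
      have h3 : p - (p + l • g) = -(l • g) := by abel
      rw [h2, h3, norm_neg, smul_smul, inv_mul_cancel₀ hl.ne', one_smul] at h1
      norm_cast
      linarith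
    have hupx : moreauEnvelope l φ (x + l • g) ≤ ((y + q : ℝ) : EReal) := by
      have h1 := moreauEnvelope_le (l := l) (x + l • g) hφx
      have h3 : x - (x + l • g) = -(l • g) := by abel
      rwa [h3, norm_neg] at h1
    have hup : ∀ t : ℝ, moreauEnvelope l φ (p + l • g - t • (x - p)) ≤
        ((b + q - t * inner ℝ g (x - p) + t ^ 2 * ((2 * l)⁻¹ * ‖x - p‖ ^ 2) : ℝ) : EReal) :=
      fun t => by
        refine (moreauEnvelope_le (l := l) _ hp).trans (le_of_eq ?_)
        have h3 : p - (p + l • g - t • (x - p)) = t • (x - p) - l • g := by abel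
        rw [h3, norm_sub_sq_real, real_inner_smul_left, real_inner_smul_right,
          real_inner_comm g (x - p), norm_smul t, mul_pow, Real.norm_eq_abs, sq_abs]
        norm_cast
        rw [hqdef]
        field_simp
        ring
    have hlim : Tendsto (fun t : ℝ => p + l • g - t • (x - p)) (𝓝[>] 0) (𝓝 (p + l • g)) := by
      have : Continuous fun t : ℝ => p + l • g - t • (x - p) := by fun_prop
      simpa using (this.tendsto 0).mono_left nhdsWithin_le_nhds
    set N := (2 * l)⁻¹ * ‖x - p‖ ^ 2 with hN
    -- `p + l • g` lies between `x + l • g` and its own shift by `-t • (x - p)`. Using `p` as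
    -- competitor at the shifted point costs only second order in `t`, so convexity divided by `t`
    -- leaves the error `t * N`.
    have hev : ∀ᶠ t : ℝ in 𝓝[>] 0, b + inner ℝ g (x - p) - t * N ≤ y := by
      filter_upwards [hlim.eventually (hO.mem_nhds hpO), self_mem_nhdsWithin] with t htO ht0
      have ht0 : 0 < t := ht0
      have h1 := he.2.2 _ hxO _ htO (t / (1 + t)) (1 / (1 + t)) (by positivity) (by positivity)
        (by field_simp; ring)
      have h2 : (t / (1 + t)) • (x + l • g) + (1 / (1 + t)) • (p + l • g - t • (x - p)) =
          p + l • g := by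
        have h3 : (1 + t) • ((t / (1 + t)) • (x + l • g) +
            (1 / (1 + t)) • (p + l • g - t • (x - p))) = (1 + t) • (p + l • g) := by
          rw [smul_add (1 + t) (_ • (x + l • g)), smul_smul, smul_smul, mul_div_cancel₀,
            mul_div_cancel₀]
          · module
          all_goals positivity
        exact smul_right_injective X (by positivity : (1 + t : ℝ) ≠ 0) h3
      rw [h2] at h1
      have h4 := (hlow.trans h1).trans (add_le_add
        (mul_le_mul_of_nonneg_left hupx (by norm_cast; positivity))
        (mul_le_mul_of_nonneg_left (hup t) (by norm_cast; positivity)))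
      norm_cast at h4
      have h5 := mul_le_mul_of_nonneg_left h4 (by positivity : 0 ≤ 1 + t)
      have h6 : (1 + t) * (t / (1 + t) * (y + q) + 1 / (1 + t) *
          (b + q - t * inner ℝ g (x - p) + t ^ 2 * N)) =
          t * (y + q) + (b + q - t * inner ℝ g (x - p) + t ^ 2 * N) := by
        field_simp
      rw [h6] at h5
      have h7 : t * (b + inner ℝ g (x - p) - t * N) ≤ t * y := by nlinarith
      exact le_of_mul_le_mul_left h7 ht0
    have hlim2 : Tendsto (fun t : ℝ => b + inner ℝ g (x - p) - t * N) (𝓝[>] 0)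
        (𝓝 (b + inner ℝ g (x - p))) := by
      have : Continuous fun t : ℝ => b + inner ℝ g (x - p) - t * N := by fun_prop
      simpa using (this.tendsto 0).mono_left nhdsWithin_le_nhds
    exact le_of_tendsto hlim2 hev

/-! ### Proximal points under weak lower semicontinuity -/

/-- Testing weak convergence against `p - x₀` and applying Cauchy–Schwarz. -/
theorem WeaklyConverges.mem_closedBall {w : ℕ → X} {p x₀ : X} {ρ : ℝ}
    (h : WeaklyConverges w p) (hw : ∀ n, w n ∈ Metric.closedBall x₀ ρ) :
    p ∈ Metric.closedBall x₀ ρ := by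
  rw [mem_closedBall_iff_norm]
  have h1 : Tendsto (fun n => (inner ℝ (w n - x₀) (p - x₀) : ℝ)) atTop
      (𝓝 (‖p - x₀‖ ^ 2)) := by
    rw [← real_inner_self_eq_norm_sq]
    simpa only [inner_sub_left] using (h (p - x₀)).sub_const (inner ℝ x₀ (p - x₀))
  have h2 : ‖p - x₀‖ ^ 2 ≤ ρ * ‖p - x₀‖ := le_of_tendsto h1 <| .of_forall fun n =>
    (real_inner_le_norm _ _).trans (by gcongr; exact mem_closedBall_iff_norm.1 (hw n))
  rcases (norm_nonneg (p - x₀)).eq_or_lt with h0 | h0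
  · rw [← h0]
    exact (norm_nonneg _).trans (mem_closedBall_iff_norm.1 (hw 0))
  · rw [sq] at h2
    exact le_of_mul_le_mul_right h2 h0

/-- Proximal points of weakly sequentially lower semicontinuous functions on balls. -/
theorem exists_prox_of_weakSeqLSCAt [CompleteSpace X] {f : X → EReal} {x₀ z : X}
    {a b l ρ : ℝ} (hl : 0 < l) (hρ : 0 ≤ ρ)
    (hf : ∀ x ∈ Metric.closedBall x₀ ρ, WeakSeqLSCAt f x) (ha : f x₀ = a)
    (hb : ∀ x ∈ Metric.closedBall x₀ ρ,
      ((b - (2 * l)⁻¹ * ‖x - z‖ ^ 2 : ℝ) : EReal) ≤ f x) :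
    ∃ p ∈ Metric.closedBall x₀ ρ, ∃ m : ℝ,
      f p = ((m - (2 * l)⁻¹ * ‖p - z‖ ^ 2 : ℝ) : EReal) ∧
      ∀ x ∈ Metric.closedBall x₀ ρ, ((m - (2 * l)⁻¹ * ‖x - z‖ ^ 2 : ℝ) : EReal) ≤ f x := by
  obtain ⟨m, w, t, hm, hwB, hw, -, htm⟩ :=
    exists_minimizing_seq (Metric.mem_closedBall_self hρ) ha hb
  obtain ⟨p, n, hn, hp⟩ := exists_weaklyConverges_subseq (w := w) (C := ‖x₀‖ + ρ) fun k => by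
    have h1 := mem_closedBall_iff_norm.1 (hwB k)
    linarith [norm_le_norm_add_norm_sub' (w k) x₀]
  have hpB := hp.mem_closedBall (fun k => hwB (n k))
  refine ⟨p, hpB, m, le_antisymm ?_ (hm p hpB), hm⟩
  refine (hf p hpB _ hp).trans ?_
  have hin : Tendsto (fun k => (inner ℝ (w (n k)) (p - z) : ℝ)) atTop (𝓝 (inner ℝ p (p - z))) :=
    hp (p - z)
  -- The quadratic is bounded below by its linearization at `p`, which is weakly continuous.
  have hlim : Tendsto (fun k => t (n k) - ((2 * l)⁻¹ * ‖p - z‖ ^ 2 +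
      l⁻¹ * (inner ℝ (w (n k)) (p - z) - inner ℝ p (p - z)))) atTop
      (𝓝 (m - (2 * l)⁻¹ * ‖p - z‖ ^ 2)) := by
    have := (htm.comp hn.tendsto_atTop).sub
      (((hin.sub_const (inner ℝ p (p - z))).const_mul l⁻¹).const_add ((2 * l)⁻¹ * ‖p - z‖ ^ 2))
    simpa using this
  have hlimE := (continuous_coe_real_ereal.tendsto _).comp hlim
  rw [← hlimE.liminf_eq]
  refine liminf_le_liminf (.of_forall fun k => (hw (n k)).trans ?_)
  simp only [Function.comp_apply]
  norm_cast
  have h1 : w (n k) - z = (w (n k) - p) + (p - z) := by abel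
  rw [h1, norm_add_sq_real, inner_sub_left (w (n k)) p (p - z)]
  have h2 : 0 ≤ (2 * l)⁻¹ * ‖w (n k) - p‖ ^ 2 := by positivity
  have h3 : l⁻¹ = 2 * (2 * l)⁻¹ := by field_simp
  rw [h3]
  linarith

/-- The minimizer on the ball is global because `hout` handles the exterior. The last bound keeps `φ
p` close to `a`, as the restriction on values in prox-regularity and variational convexity requires.
-/
theorem exists_global_prox [CompleteSpace X] {φ : X → EReal} {x₀ v₀ z : X} {a r l ρ : ℝ}
    (hl : 0 < l) (hρ : 0 ≤ ρ) (hr : 0 ≤ r) (hrl : r * l ≤ 1 / 2) (ha : φ x₀ = a)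
    (hw : ∀ x ∈ Metric.closedBall x₀ ρ, WeakSeqLSCAt φ x)
    (hball : ∀ x ∈ Metric.closedBall x₀ ρ,
      ((a + inner ℝ v₀ (x - x₀) - r / 2 * ‖x - x₀‖ ^ 2 : ℝ) : EReal) ≤ φ x)
    (hout : ∀ v x : X, ‖v‖ ≤ ‖v₀‖ + 1 → ρ ≤ ‖x - x₀‖ →
      ((a + inner ℝ v (x - x₀) - (2 * l)⁻¹ * ‖x - x₀‖ ^ 2 : ℝ) : EReal) ≤ φ x)
    (hz : ‖z - (x₀ + l • v₀)‖ ≤ l) :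
    ∃ (p : X) (m : ℝ), φ p = ((m - (2 * l)⁻¹ * ‖p - z‖ ^ 2 : ℝ) : EReal) ∧
      (∀ x, ((m - (2 * l)⁻¹ * ‖x - z‖ ^ 2 : ℝ) : EReal) ≤ φ x) ∧
      ‖p - x₀‖ ≤ 4 * ‖z - (x₀ + l • v₀)‖ ∧
      φ p ≤ ((a + (‖v₀‖ + 1) * (4 * ‖z - (x₀ + l • v₀)‖) : ℝ) : EReal) := by
  have hxρ : x₀ ∈ Metric.closedBall x₀ ρ := Metric.mem_closedBall_self hρ
  obtain ⟨p, hpB, m, hpm, hm⟩ := exists_prox_of_weakSeqLSCAt (z := z)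
    (b := a - ‖v₀‖ * ρ - r / 2 * ρ ^ 2) hl hρ hw ha fun x hx => by
      refine le_trans ?_ (hball x hx)
      norm_cast
      have h0 := mem_closedBall_iff_norm.1 hx
      have h1 := (neg_le_abs _).trans (abs_real_inner_le_norm v₀ (x - x₀))
      have h2 : ‖v₀‖ * ‖x - x₀‖ ≤ ‖v₀‖ * ρ := by gcongr
      have h3 : r / 2 * ‖x - x₀‖ ^ 2 ≤ r / 2 * ρ ^ 2 := by gcongr
      have h4 : 0 ≤ (2 * l)⁻¹ * ‖x - z‖ ^ 2 := by positivity
      linarith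
  have hma : m - (2 * l)⁻¹ * ‖x₀ - z‖ ^ 2 ≤ a := by
    have := hm x₀ hxρ
    rw [ha] at this
    exact_mod_cast this
  have hdist : ‖p - x₀‖ ≤ 4 * ‖z - (x₀ + l • v₀)‖ := by
    refine norm_sub_le_of_prox hl hrl ?_ hma
    have := hball p hpB
    rw [hpm] at this
    exact_mod_cast this
  have hslope := norm_inv_smul_sub_le hl hz
  refine ⟨p, m, hpm, fun x => ?_, hdist, ?_⟩
  · rcases le_total ‖x - x₀‖ ρ with hx | hx
    · exact hm x (mem_closedBall_iff_norm.2 hx)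
    · refine le_trans ?_ (hout (l⁻¹ • (z - x₀)) x hslope hx)
      norm_cast
      have h2 := prox_identity hl m x₀ x z
      linarith
  · rw [hpm]
    norm_cast
    have h2 := prox_identity hl m x₀ p z
    have h3 := real_inner_le_norm (l⁻¹ • (z - x₀)) (p - x₀)
    have h4 : ‖l⁻¹ • (z - x₀)‖ * ‖p - x₀‖ ≤ (‖v₀‖ + 1) * (4 * ‖z - (x₀ + l • v₀)‖) := by
      gcongr
    have h5 : 0 ≤ (2 * l)⁻¹ * ‖p - x₀‖ ^ 2 := by positivity
    linarith

/-! ### The supremum of affine minorants; (ii) implies variational convexity -/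

/-- The supremum of the affine functions `x ↦ b + ⟪g, x - p⟫` over the triples `(b, p, g) ∈ S`. -/
noncomputable def affineSup (S : Set (ℝ × X × X)) (x : X) : EReal :=
  ⨆ s : S, ((s.1.1 + inner ℝ s.1.2.2 (x - s.1.2.1) : ℝ) : EReal)

theorem le_affineSup {S : Set (ℝ × X × X)} {b : ℝ} {p g : X} (h : (b, p, g) ∈ S) (x : X) :
    ((b + inner ℝ g (x - p) : ℝ) : EReal) ≤ affineSup S x :=
  le_iSup (fun s : S => ((s.1.1 + inner ℝ s.1.2.2 (x - s.1.2.1) : ℝ) : EReal)) ⟨_, h⟩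

theorem lowerSemicontinuous_affineSup (S : Set (ℝ × X × X)) :
    LowerSemicontinuous (affineSup S) := by
  refine lowerSemicontinuous_iSup fun s => Continuous.lowerSemicontinuous ?_
  exact continuous_coe_real_ereal.comp (by fun_prop)

theorem extConvexOn_affineSup {S : Set (ℝ × X × X)} (hS : S.Nonempty) :
    ExtConvexOn Set.univ (affineSup S) := by
  obtain ⟨⟨b, p, g⟩, hs⟩ := hS
  refine ⟨convex_univ, fun x _ hx => ?_, fun x _ y _ c d hc hd hcd => iSup_le fun s => ?_⟩
  · exact absurd (le_bot_iff.1 (hx ▸ le_affineSup hs x)) (EReal.coe_ne_bot _)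
  · obtain ⟨⟨b, p, g⟩, hs⟩ := s
    refine le_trans (le_of_eq ?_) (add_le_add
      (mul_le_mul_of_nonneg_left (le_affineSup hs x) (by exact_mod_cast hc.le))
      (mul_le_mul_of_nonneg_left (le_affineSup hs y) (by exact_mod_cast hd.le)))
    norm_cast
    obtain rfl : d = 1 - c := by linarith
    have h1 : c • x + (1 - c) • y - p = c • (x - p) + (1 - c) • (y - p) := by module
    rw [h1, inner_add_right, inner_smul_right, inner_smul_right]
    ring

theorem norm_add_smul_sub_lt {l δ : ℝ} (hl : 0 < l) {x g x₀ v₀ : X} (hx : ‖x - x₀‖ < δ)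
    (hg : ‖g - v₀‖ < δ) : ‖x + l • g - (x₀ + l • v₀)‖ < (1 + l) * δ := by
  have h1 : x + l • g - (x₀ + l • v₀) = (x - x₀) + l • (g - v₀) := by
    rw [smul_sub]
    abel
  rw [h1]
  refine (norm_add_le _ _).trans_lt ?_
  rw [norm_smul, Real.norm_of_nonneg hl.le]
  have := mul_lt_mul_of_pos_left hg hl
  linarith

theorem ProxRegular.variationallyConvex [CompleteSpace X] {φ : X → EReal} {x₀ v₀ : X}
    (hbot : ∀ x, φ x ≠ ⊥) (hpb : ProxBounded φ) (hdom : φ x₀ ≠ ⊤)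
    (hsub : v₀ ∈ limitingSubdifferential φ x₀) (hweak : WeakSeqLSCAround φ x₀)
    (hreg : ProxRegular φ x₀ v₀) {l₀ : ℝ} (hl₀ : 0 < l₀)
    (henv : ∀ l : ℝ, 0 < l → l < l₀ →
      LocallyConvexAround (moreauEnvelope l φ) (x₀ + l • v₀)) :
    VariationallyConvex φ x₀ v₀ := by
  obtain ⟨ε, r, hε, hr, hprox⟩ := hreg
  obtain ⟨ρ, hρ, hW⟩ := Metric.nhds_basis_closedBall.eventually_iff.1 hweak
  obtain ⟨a, ha⟩ := exists_coe_eq (hbot x₀) hdom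
  set e := min ε (min ρ 1) with he
  have he0 : 0 < e := by positivity
  have heε : e ≤ ε := min_le_left _ _
  have heρ : e ≤ ρ := (min_le_right _ _).trans (min_le_left _ _)
  have he1 : e ≤ 1 := (min_le_right _ _).trans (min_le_right _ _)
  -- Radius `e / 2` and height `a + e` allow any base point `u` within `e / 2` of `x₀` with value
  -- below `a + e`: points outside the `e`-ball are then at least `e / 2` from `u`.
  obtain ⟨l₁, hl₁, hco⟩ := hpb.exists_coercive x₀ (half_pos he0) (a + e) (‖v₀‖ + 1)
  set l := min (l₀ / 2) (min (l₁ / 2) (1 / (2 * (r + 1)))) with hldef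
  have hl : 0 < l := by positivity
  have hll₀ : l < l₀ := (min_le_left _ _).trans_lt (half_lt_self hl₀)
  have hll₁ : l < l₁ :=
    ((min_le_right _ _).trans (min_le_left _ _)).trans_lt (half_lt_self hl₁)
  have hrl : r * l ≤ 1 / 2 := by
    have h1 : l ≤ 1 / (2 * (r + 1)) := (min_le_right _ _).trans (min_le_right _ _)
    rw [le_div_iff₀ (by positivity)] at h1
    linarith
  have hrc : r / 2 ≤ (2 * l)⁻¹ := by
    rw [inv_eq_one_div, le_div_iff₀ (by positivity)]
    linarith
  obtain ⟨O, hO, hzO, heO⟩ := henv l hl hll₀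
  obtain ⟨η, hη, hηO⟩ := Metric.isOpen_iff.1 hO _ hzO
  set δ := min (e / 2) (η / (1 + l)) with hδdef
  have hδ : 0 < δ := by positivity
  have hδe : δ ≤ e / 2 := min_le_left _ _
  have hmemO : ∀ x g : X, ‖x - x₀‖ < δ → ‖g - v₀‖ < δ → x + l • g ∈ O := fun x g hx hg => by
    refine hηO (mem_ball_iff_norm.2 ((norm_add_smul_sub_lt hl hx hg).trans_le ?_))
    have : δ ≤ η / (1 + l) := min_le_right _ _
    rwa [le_div_iff₀ (by positivity), mul_comm] at this
  -- For `z` within `κ` of `x₀ + l • v₀` the four bounds give, in order: slope at most `‖v₀‖ + 1`,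
  -- `‖p - x₀‖ < δ`, `‖g - v₀‖ < δ`, and `φ p < a + e`.
  set κ := min l (min (δ / 4) (min (δ * l / 5) (e / (4 * (‖v₀‖ + 1))))) with hκdef
  have hκ : 0 < κ := by positivity
  set δ' := min δ (κ / (1 + l)) with hδ'def
  have hδ' : 0 < δ' := by positivity
  have hδδ' : δ' ≤ δ := min_le_left _ _
  -- triples `(φ p, p, g)` where `p` is a proximal point of `p + l • g`
  set S : Set (ℝ × X × X) := {s | φ s.2.1 = s.1 ∧ ‖s.2.1 - x₀‖ < δ ∧ ‖s.2.2 - v₀‖ < δ ∧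
    s.1 < a + e ∧ ∀ y, ((s.1 + inner ℝ s.2.2 (y - s.2.1) -
      (2 * l)⁻¹ * ‖y - s.2.1‖ ^ 2 : ℝ) : EReal) ≤ φ y} with hS
  -- Prox-regularity covers the `e`-ball, since `r ≤ l⁻¹`; coercivity covers the rest.
  have hmemS : ∀ u v : X, ‖u - x₀‖ < δ → ‖v - v₀‖ < δ → v ∈ limitingSubdifferential φ u →
      ∀ b : ℝ, φ u = b → b < a + e → (b, u, v) ∈ S := fun u v hu hv hvu b hb hba => by
    refine ⟨hb, hu, hv, hba, fun y => ?_⟩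
    rcases le_total ‖y - x₀‖ e with hy | hy
    · have h1 := hprox y (mem_closedBall_iff_norm.2 (hy.trans heε)) u
        (mem_closedBall_iff_norm.2 (by linarith)) v (mem_closedBall_iff_norm.2 (by linarith)) hvu
        (by rw [hb, ha]; exact_mod_cast hba.trans_le (by linarith))
      refine le_trans ?_ h1
      rw [hb]
      norm_cast
      have := mul_le_mul_of_nonneg_right hrc (sq_nonneg ‖y - u‖)
      linarith
    · refine le_trans ?_ (hco l hl hll₁ u v y (by linarith) ?_ ?_)
      · norm_cast
        linarith
      · linarith [norm_le_norm_add_norm_sub' v v₀]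
      · have h1 : y - x₀ = (y - u) + (u - x₀) := by abel
        have h2 := norm_add_le (y - u) (u - x₀)
        rw [← h1] at h2
        linarith
  have hx₀S : (a, x₀, v₀) ∈ S :=
    hmemS x₀ v₀ (by simpa) (by simpa) hsub a ha (by linarith)
  have hSle : ∀ x, ‖x - x₀‖ < δ → affineSup S x ≤ φ x := fun x hx => by
    refine iSup_le fun s => ?_
    obtain ⟨⟨b, p, g⟩, hb, hp, hg, -, hq⟩ := s
    exact heO.affine_le_of_moreauEnvelope hl hO hb hq (hmemO p g hp hg) (hmemO x g hx hg)
  have hSconv := extConvexOn_affineSup ⟨_, hx₀S⟩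
  have hSeq : ∀ b u v, (b, u, v) ∈ S → affineSup S u = b := fun b u v h => by
    refine le_antisymm ((hSle u h.2.1).trans h.1.le) ?_
    simpa using le_affineSup h u
  have hproxS : ∀ z : X, ‖z - (x₀ + l • v₀)‖ < κ →
      ∃ (b : ℝ) (p g : X), (b, p, g) ∈ S ∧ z = p + l • g := fun z hz => by
    have hz1 : ‖z - (x₀ + l • v₀)‖ < l := hz.trans_le (min_le_left _ _)
    have hz2 : ‖z - (x₀ + l • v₀)‖ < δ / 4 :=
      hz.trans_le ((min_le_right _ _).trans (min_le_left _ _))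
    have hz3 : ‖z - (x₀ + l • v₀)‖ < δ * l / 5 :=
      hz.trans_le ((min_le_right _ _).trans ((min_le_right _ _).trans (min_le_left _ _)))
    have hz4 : ‖z - (x₀ + l • v₀)‖ < e / (4 * (‖v₀‖ + 1)) :=
      hz.trans_le ((min_le_right _ _).trans ((min_le_right _ _).trans (min_le_right _ _)))
    obtain ⟨p, m, hpm, hm, hdist, hval⟩ := exists_global_prox (z := z) hl he0.le hr hrl ha
      (fun x hx => hW (Metric.closedBall_subset_closedBall heρ hx))
      (fun x hx => by
        have h1 := hprox x (Metric.closedBall_subset_closedBall heε hx) x₀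
          (Metric.mem_closedBall_self hε.le) v₀ (Metric.mem_closedBall_self hε.le) hsub
          (by rw [ha]; exact_mod_cast (by linarith : a < a + ε))
        rw [ha, ← EReal.coe_add] at h1
        rwa [add_sub_assoc])
      (fun v x hv hx => by
        refine le_trans ?_ (hco l hl hll₁ x₀ v x (by simp) hv (by linarith))
        norm_cast
        linarith)
      hz1.le
    refine ⟨m - (2 * l)⁻¹ * ‖p - z‖ ^ 2, p, l⁻¹ • (z - p),
      ⟨hpm, by linarith, ?_, ?_, fun y => ?_⟩, ?_⟩
    · refine (norm_smul_sub_sub_le hl hdist).trans_lt ((div_lt_iff₀ hl).2 ?_)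
      linarith
    · rw [hpm] at hval
      norm_cast at hval
      refine hval.trans_lt ?_
      rw [lt_div_iff₀ (by positivity)] at hz4
      linarith
    · simp only
      rw [prox_identity hl]
      exact hm y
    · rw [smul_smul, mul_inv_cancel₀ hl.ne', one_smul]
      abel
  -- near `(x₀, v₀)` every subgradient of the supremum comes from a proximal point
  have hconv : ∀ u v : X, ‖u - x₀‖ < δ' → ‖v - v₀‖ < δ' →
      v ∈ limitingSubdifferential (affineSup S) u → ∃ b : ℝ, (b, u, v) ∈ S :=
    fun u v hu hv hvu => by
      obtain ⟨b, p, g, hbpg, hz⟩ := hproxS (u + l • v) <| by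
        refine (norm_add_smul_sub_lt hl hu hv).trans_le ?_
        have : δ' ≤ κ / (1 + l) := min_le_right _ _
        rwa [le_div_iff₀ (by positivity), mul_comm] at this
      obtain ⟨c, hc⟩ := exists_coe_eq (hSconv.2.1 u (Set.mem_univ u)) hvu.1
      have h1 := hSconv.le_of_mem_limitingSubdifferential isOpen_univ (Set.mem_univ u) hc hvu
        (Set.mem_univ p)
      rw [hSeq b p g hbpg] at h1
      have h2 := le_affineSup hbpg u
      rw [hc] at h2
      norm_cast at h1 h2
      -- Adding `h1` and `h2` gives `⟪g - v, u - p⟫ ≤ 0`; since `u - p = l • (g - v)`, both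
      -- differences vanish.
      have h3 : u - p = l • (g - v) := by
        rw [smul_sub, sub_eq_sub_iff_add_eq_add, hz]
        abel
      have h4 : p - u = -(l • (g - v)) := by rw [← h3, neg_sub]
      rw [h4, inner_neg_right, real_inner_smul_right] at h1
      rw [h3, real_inner_smul_right] at h2
      have h5 : l * ‖g - v‖ ^ 2 ≤ 0 := by
        rw [← real_inner_self_eq_norm_sq, inner_sub_left]
        linarith
      have h6 : ‖g - v‖ = 0 := by
        by_contra hne
        have : 0 < l * ‖g - v‖ ^ 2 := by positivity
        linarith
      have h7 : g - v = 0 := norm_eq_zero.1 h6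
      rw [h7, smul_zero, sub_eq_zero] at h3
      rw [sub_eq_zero] at h7
      subst h3 h7
      exact ⟨b, hbpg⟩
  refine ⟨Metric.ball x₀ δ', Metric.ball v₀ δ', Metric.isOpen_ball, convex_ball _ _,
    Metric.mem_ball_self hδ', Metric.isOpen_ball, convex_ball _ _, Metric.mem_ball_self hδ',
    affineSup S, ⟨convex_ball _ _, fun x _ => hSconv.2.1 x (Set.mem_univ x),
      fun x _ y _ => hSconv.2.2 x (Set.mem_univ x) y (Set.mem_univ y)⟩,
    (lowerSemicontinuous_affineSup S).lowerSemicontinuousOn _,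
    fun x hx => hSle x ((mem_ball_iff_norm.1 hx).trans_le hδδ'), e, he0, ?_, ?_⟩
  · ext ⟨u, v⟩
    simp only [Set.mem_ofPred_eq, mem_ball_iff_norm]
    constructor
    · rintro ⟨⟨hu, hlt⟩, hv, hvu⟩
      obtain ⟨b, hb⟩ := exists_coe_eq (hbot u) hvu.1
      rw [hb, ha] at hlt
      have hbS := hmemS u v (hu.trans_le hδδ') (hv.trans_le hδδ') hvu b hb (by exact_mod_cast hlt)
      refine ⟨hu, hv, mem_limitingSubdifferential_of_quadratic (c := 0) (hSeq b u v hbS)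
        (.of_forall fun x => ?_)⟩
      simpa using le_affineSup hbS x
    · rintro ⟨hu, hv, hvu⟩
      obtain ⟨b, hb, -, -, hlt, hq⟩ := hconv u v hu hv hvu
      refine ⟨⟨hu, ?_⟩, hv,
        mem_limitingSubdifferential_of_quadratic hb (.of_forall hq)⟩
      rw [show φ u = b from hb, ha]
      exact_mod_cast hlt
  · intro u hu v hv hvu
    obtain ⟨b, hb⟩ := hconv u v (mem_ball_iff_norm.1 hu) (mem_ball_iff_norm.1 hv) hvu
    rw [hSeq b u v hb]
    exact hb.1

end VarConv

theorem corollary6p7 {X : Type*} [NormedAddCommGroup X] [InnerProductSpace ℝ X] [CompleteSpace X]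
    (φ : X → EReal) (hbot : ∀ x, φ x ≠ ⊥) (hlsc : LowerSemicontinuous φ)
    (hpb : VarConv.ProxBounded φ)
    (x₀ v₀ : X) (hdom : φ x₀ ≠ ⊤) (hsub : v₀ ∈ VarConv.limitingSubdifferential φ x₀) :
    (VarConv.VariationallyConvex φ x₀ v₀ →
      VarConv.ProxRegular φ x₀ v₀ ∧
        ∃ l₀ : ℝ, 0 < l₀ ∧ ∀ l : ℝ, 0 < l → l < l₀ →
          VarConv.LocallyConvexAround (VarConv.moreauEnvelope l φ) (x₀ + l • v₀)) ∧
    (VarConv.WeakSeqLSCAround φ x₀ →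
      (VarConv.ProxRegular φ x₀ v₀ ∧
        ∃ l₀ : ℝ, 0 < l₀ ∧ ∀ l : ℝ, 0 < l → l < l₀ →
          VarConv.LocallyConvexAround (VarConv.moreauEnvelope l φ) (x₀ + l • v₀)) →
      VarConv.VariationallyConvex φ x₀ v₀) := by
  refine ⟨fun h => ⟨h.proxRegular hbot hdom hsub,
    h.locallyConvexAround_moreauEnvelope hbot hpb hdom hsub⟩, ?_⟩
  rintro hweak ⟨hreg, l₀, hl₀, henv⟩
  exact hreg.variationallyConvex hbot hpb hdom hsub hweak hl₀ henv
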